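/- All graphs are finite, undirected and simple. For a graph $G$ on $n$ vertices let $\lambda_1(G)\ge\lambda_2(G)\ge\dots\ge\lambda_n(G)$ be the eigenvalues of its adjacency matrix, counted with multiplicity. The edge connectivity $\kappa'(G)$ is the greatest integer $m$ such that deleting fewer than $m$ edges never disconnects $G$ (for the one-vertex graph put $\kappa'=0$). For an integer $k$, a spanning $k$-tree of $G$ is a spanning subgraph of $G$ that is a tree of maximum degree at most $k$. Theorem. Let $k\ge 3$ be an integer, let $G$ be a connected $d$-regular graph on $n$ vertices with edge connectivity $\kappa'$, and set $l=d-(k-2)\kappa'$. (i) If $l\le 0$, then $G$ has a spanning $k$-tree. (ii) If $l>0$ and $$\lambda_{\lceil 3d/l\rceil}(G) < d-\frac{d}{(k-2)(d+1)},$$ then $G$ has a spanning $k$-tree. Here, if $\lceil 3d/l\rceil>n$, so that there is no such eigenvalue, the inequality is regarded as satisfied. -/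

import Mathlib

namespace SimpleGraph

/-- The edge connectivity of `G`: the greatest `m` such that `G` is `m`-edge-connected, that is,
such that deleting fewer than `m` edges never separates two vertices.  (On a graph with at most one
vertex there is no greatest `m`, and the value is `0`.) -/
noncomputable def edgeConnectivity {V : Type*} (G : SimpleGraph V) : ℕ :=
  sSup {m : ℕ | G.IsEdgeConnected m}

/-- The eigenvalues of the adjacency matrix of `G`, with multiplicity and in nonincreasing order.
The indices start at `0`: `G.adjEigenvalue i` is the `(i + 1)`-st largest eigenvalue. -/
noncomputable def adjEigenvalue {V : Type*} [Fintype V] [DecidableEq V] (G : SimpleGraph V)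
    [DecidableRel G.Adj] (i : Fin (Fintype.card V)) : ℝ :=
  (G.isHermitian_adjMatrix ℝ).eigenvalues₀ i

open Classical in
/-- `G` has a spanning `k`-tree: a spanning subgraph (on the same vertex set) that is a tree of
maximum degree at most `k`. -/
def HasSpanningKTree {V : Type*} [Fintype V] (G : SimpleGraph V) (k : ℕ) : Prop :=
  ∃ T : SimpleGraph V, T ≤ G ∧ T.IsTree ∧ T.maxDegree ≤ k

end SimpleGraph

/-! Write `q = k - 2`. By Win's theorem (`exists_many_components`), if a connected `G` has no
spanning `k`-tree, then deleting some nonempty `X` leaves at least `q|X| + 3` components. Each of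
them sends at least `κ'` edges to `X`, and `X` receives at most `d|X|`. If `m` components send fewer
than `d/q` edges, this count gives `3d ≤ m(d - qκ') = ml`; hence `l > 0` and `m ≥ ⌈3d/l⌉`. Each of
these `m` components sends fewer than `d` edges, so it has at least `d + 1` vertices and average
inner degree at least `d - d/(q(d+1))`. There are no edges between them, so `λ_m` is at least this
number (`le_adjEigenvalue_of_parts`), against the hypothesis.

For Win's theorem, let the spanning tree `T` minimise the total excess of the degrees over `k`.
Among the sets `X` that contain all vertices of degree above `k` and only vertices of degree at
least `k`, consider those for which `T` can be rearranged inside any component of `T - X` so that a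
prescribed vertex of it gets degree below `k`; take a smallest. If an edge `uv` of `G` joined two
components of `T - X`, one could make room at `u` and `v`, add `uv`, and drop an edge at a vertex `w
∈ X` of the `T`-path from `u` to `v` (`exists_edge_exchange`). This lowers the excess if `w` has
degree above `k`; if no such `w` exists, the path can be removed from `X`. Both are impossible, so
`G - X` and `T - X` have the same components, and these are counted in the tree
(`IsTree.card_components_ge`). -/

namespace SimpleGraph

variable {V : Type*}

/-! ### Local changes and edge exchange in a tree -/

/-- The edges of `H` with both ends in `S`, as a graph on the whole vertex set. -/
def restrictTo (H : SimpleGraph V) (S : Set V) : SimpleGraph V where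
  Adj a b := H.Adj a b ∧ a ∈ S ∧ b ∈ S
  symm := ⟨fun _ _ h => ⟨h.1.symm, h.2.2, h.2.1⟩⟩
  loopless := ⟨fun _ h => h.1.ne rfl⟩

@[simp] lemma restrictTo_adj {H : SimpleGraph V} {S : Set V} {a b : V} :
    (H.restrictTo S).Adj a b ↔ H.Adj a b ∧ a ∈ S ∧ b ∈ S := Iff.rfl

lemma restrictTo_le (H : SimpleGraph V) (S : Set V) : H.restrictTo S ≤ H := fun _ _ h => h.1

lemma restrictTo_mono (H : SimpleGraph V) {S S' : Set V} (h : S ⊆ S') :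
    H.restrictTo S ≤ H.restrictTo S' := fun _ _ hab => ⟨hab.1, h hab.2.1, h hab.2.2⟩

lemma Walk.reachable_of_edges {A B : SimpleGraph V} {a b : V} (p : A.Walk a b)
    (h : ∀ x y, s(x, y) ∈ p.edges → B.Reachable x y) : B.Reachable a b := by
  induction p with
  | nil => exact .rfl
  | cons hadj q ih =>
    exact (h _ _ (by simp)).trans (ih fun x y hxy => h x y (by simp [hxy]))

lemma Reachable.of_adj_imp {A B : SimpleGraph V} {a b : V} (hab : A.Reachable a b)
    (h : ∀ x y, A.Adj x y → B.Reachable x y) : B.Reachable a b := by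
  obtain ⟨p⟩ := hab
  exact p.reachable_of_edges fun x y hxy => h x y (p.adj_of_mem_edges hxy)

open Classical in
/-- `H` arises from `T` by changing edges inside `C` only: `T`-neighbours in `C` stay connected
inside `C`, and the degrees on `C` are at most `k`. -/
structure IsLocalVariant [Fintype V] (G T : SimpleGraph V) (C : Set V) (k : ℕ)
    (H : SimpleGraph V) : Prop where
  le : H ≤ G
  agree : ∀ a b, ¬(a ∈ C ∧ b ∈ C) → (H.Adj a b ↔ T.Adj a b)
  lift : ∀ a b, T.Adj a b → a ∈ C → b ∈ C → (H.restrictTo C).Reachable a b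
  degree_le : ∀ a ∈ C, H.degree a ≤ k

open Classical in
lemma degree_le_of_adj_imp [Fintype V] {A B : SimpleGraph V} {a : V}
    (h : ∀ b, A.Adj a b → B.Adj a b) : A.degree a ≤ B.degree a := by
  rw [← card_neighborFinset_eq_degree, ← card_neighborFinset_eq_degree]
  exact Finset.card_le_card fun b hb => by simpa using h b (by simpa using hb)

open Classical in
lemma degree_le_add_one_of_adj_imp [Fintype V] {A B : SimpleGraph V} {a c : V}
    (h : ∀ b, A.Adj a b → B.Adj a b ∨ b = c) : A.degree a ≤ B.degree a + 1 := by
  rw [← card_neighborFinset_eq_degree, ← card_neighborFinset_eq_degree]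
  refine (Finset.card_le_card (t := insert c (B.neighborFinset a)) fun b hb => ?_).trans
    (Finset.card_insert_le _ _)
  have := h b (by simpa using hb)
  simpa [or_comm] using this

open Classical in
lemma degree_lt_of_adj_imp [Fintype V] {A B : SimpleGraph V} {a c : V}
    (h : ∀ b, A.Adj a b → B.Adj a b ∧ b ≠ c) (hc : B.Adj a c) : A.degree a < B.degree a := by
  rw [← card_neighborFinset_eq_degree, ← card_neighborFinset_eq_degree]
  refine Finset.card_lt_card ((Finset.ssubset_iff_of_subset fun b hb => ?_).2 ⟨c, by simpa, ?_⟩)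
  · simpa using (h b (by simpa using hb)).1
  · intro hc'
    exact (h c (by simpa using hc')).2 rfl

/-- The graph that agrees with `A` inside `C` and with `B` elsewhere. -/
def splice (A B : SimpleGraph V) (C : Set V) : SimpleGraph V where
  Adj a b := (a ∈ C ∧ b ∈ C ∧ A.Adj a b) ∨ (¬(a ∈ C ∧ b ∈ C) ∧ B.Adj a b)
  symm := ⟨fun a b h => by
    rcases h with h | h
    · exact .inl ⟨h.2.1, h.1, h.2.2.symm⟩
    · exact .inr ⟨fun h' => h.1 ⟨h'.2, h'.1⟩, h.2.symm⟩⟩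
  loopless := ⟨fun a h => by rcases h with h | h <;> exact h.elim (by simp)⟩

lemma splice_adj {A B : SimpleGraph V} {C : Set V} {a b : V} :
    (splice A B C).Adj a b ↔ (a ∈ C ∧ b ∈ C ∧ A.Adj a b) ∨ (¬(a ∈ C ∧ b ∈ C) ∧ B.Adj a b) :=
  Iff.rfl

lemma deleteEdges_sup_edge_adj {K : SimpleGraph V} {e : Sym2 V} {u v a b : V} (hne : u ≠ v) :
    (K.deleteEdges {e} ⊔ edge u v).Adj a b ↔ (K.Adj a b ∧ s(a, b) ≠ e) ∨ s(a, b) = s(u, v) := by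
  have h : (edge u v).Adj a b ↔ s(a, b) = s(u, v) := by
    rw [edge_adj, Sym2.eq_iff]
    refine ⟨fun h => by tauto, fun h => ⟨by tauto, ?_⟩⟩
    rcases h with ⟨rfl, rfl⟩ | ⟨rfl, rfl⟩
    · exact hne
    · exact hne.symm
  rw [sup_adj, h, deleteEdges_adj, Set.mem_singleton_iff]

open Classical in
/-- Replace an edge at a vertex `w` of the `T`-path from `u` to `v` by the edge `uv`, after making
room at `u` and at `v` by local variants of `T`. -/
lemma exists_edge_exchange [Fintype V] {G T Hu Hv : SimpleGraph V} {Cu Cv : Set V} {k : ℕ}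
    {u v w : V} (hHu : IsLocalVariant G T Cu k Hu) (hHv : IsLocalVariant G T Cv k Hv)
    (hdisj : ∀ a ∈ Cu, a ∉ Cv) (hu : u ∈ Cu) (hv : v ∈ Cv) (hdu : Hu.degree u < k)
    (hdv : Hv.degree v < k) (huv : G.Adj u v) (p : T.Walk u v) (hp : p.IsPath)
    (hw : w ∈ p.support) (hwu : w ∉ Cu) (hwv : w ∉ Cv) :
    ∃ H : SimpleGraph V, H ≤ G ∧ (∀ a, a ∈ Cu ∨ a ∈ Cv → H.degree a ≤ k) ∧
      (∀ a, a ∉ Cu → a ∉ Cv → H.degree a ≤ T.degree a) ∧ H.degree w < T.degree w ∧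
      ∀ D : Set V, Cu ⊆ D → Cv ⊆ D → (∀ x ∈ p.support, x ∈ D) →
        (∀ a b, ¬(a ∈ D ∧ b ∈ D) → (H.Adj a b ↔ T.Adj a b)) ∧
        ∀ a b, T.Adj a b → a ∈ D → b ∈ D → (H.restrictTo D).Reachable a b := by
  obtain ⟨w', hww', q1, q2, hpq⟩ : ∃ w', ∃ h : T.Adj w w', ∃ (q1 : T.Walk u w) (q2 : T.Walk w' v),
      p = q1.append (.cons h q2) := by
    have hspec := p.take_spec hw
    have hwv' : w ≠ v := by rintro rfl; exact hwv hv
    revert hspec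
    cases p.dropUntil w hw with
    | nil => exact absurd rfl hwv'
    | cons h q => intro hspec; exact ⟨_, h, _, q, hspec.symm⟩
  have hnodup : p.edges.Nodup := hp.isTrail.edges_nodup
  rw [hpq, Walk.edges_append, Walk.edges_cons, List.nodup_append] at hnodup
  have he1 : s(w, w') ∉ q1.edges := fun h => hnodup.2.2 _ h _ (by simp) rfl
  have he2 : s(w, w') ∉ q2.edges := (List.nodup_cons.1 hnodup.2.1).1
  -- `K` carries out both variants at once, which is consistent because `Cu` and `Cv` are disjoint;
  -- `H` then trades `ww'` for `uv`.
  obtain ⟨K, hK⟩ : ∃ K : SimpleGraph V, ∀ a b, K.Adj a b ↔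
      (a ∈ Cu ∧ b ∈ Cu ∧ Hu.Adj a b) ∨ (¬(a ∈ Cu ∧ b ∈ Cu) ∧ Hv.Adj a b) :=
    ⟨splice Hu Hv Cu, fun _ _ => splice_adj⟩
  have hKu : ∀ a ∈ Cu, ∀ b, K.Adj a b ↔ Hu.Adj a b := by
    intro a ha b
    rw [hK]
    by_cases hb : b ∈ Cu
    · simp [ha, hb]
    · have h1 := hHu.agree a b (fun h => hb h.2)
      have h2 := hHv.agree a b (fun h => hdisj a ha h.1)
      simp [hb, h1, h2]
  have hKv : ∀ a, a ∉ Cu → ∀ b, K.Adj a b ↔ Hv.Adj a b := by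
    intro a ha b
    simp [hK, ha]
  have hKo : ∀ a b, ¬(a ∈ Cu ∧ b ∈ Cu) → ¬(a ∈ Cv ∧ b ∈ Cv) → (K.Adj a b ↔ T.Adj a b) := by
    intro a b h1 h2
    rw [hK, hHv.agree a b h2]
    tauto
  have hKG : K ≤ G := by
    intro a b h
    rcases (hK a b).1 h with h | h
    · exact hHu.le h.2.2
    · exact hHv.le h.2
  obtain ⟨H, hHadj⟩ : ∃ H : SimpleGraph V,
      ∀ a b, H.Adj a b ↔ (K.Adj a b ∧ s(a, b) ≠ s(w, w')) ∨ s(a, b) = s(u, v) :=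
    ⟨K.deleteEdges {s(w, w')} ⊔ edge u v, fun _ _ => deleteEdges_sup_edge_adj huv.ne⟩
  have hmono : ∀ a, a ≠ u → a ≠ v → H.degree a ≤ K.degree a := fun a h1 h2 =>
    degree_le_of_adj_imp fun b hb => by
      rcases (hHadj a b).1 hb with h | h
      · exact h.1
      · rw [Sym2.eq_iff] at h; tauto
  have hmono' : ∀ a, H.degree a ≤ K.degree a + 1 := fun a =>
    degree_le_add_one_of_adj_imp (c := if a = u then v else u) fun b hb => by
      rcases (hHadj a b).1 hb with h | h
      · exact .inl h.1
      · right
        rw [Sym2.eq_iff] at h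
        rcases h with ⟨rfl, rfl⟩ | ⟨rfl, rfl⟩
        · simp
        · simp [huv.ne']
  have hne1 : w ≠ u := by rintro rfl; exact hwu hu
  have hne2 : w ≠ v := by rintro rfl; exact hwv hv
  refine ⟨H, ?_, ?_, ?_, ?_, ?_⟩
  · intro a b hab
    rcases (hHadj a b).1 hab with h | h
    · exact hKG h.1
    · rw [Sym2.eq_iff] at h
      rcases h with ⟨rfl, rfl⟩ | ⟨rfl, rfl⟩
      · exact huv
      · exact huv.symm
  · intro a ha
    by_cases hau : a ∈ Cu
    · have hd : K.degree a ≤ Hu.degree a := degree_le_of_adj_imp fun b hb => (hKu a hau b).1 hb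
      by_cases h : a = u
      · subst h; have := hmono' a; omega
      · have h2 : a ≠ v := by rintro rfl; exact hdisj _ hau hv
        exact (hmono a h h2).trans (hd.trans (hHu.degree_le a hau))
    · have hav : a ∈ Cv := ha.resolve_left hau
      have hd : K.degree a ≤ Hv.degree a := degree_le_of_adj_imp fun b hb => (hKv a hau b).1 hb
      by_cases h : a = v
      · subst h; have := hmono' a; omega
      · have h2 : a ≠ u := by rintro rfl; exact hau hu
        exact (hmono a h2 h).trans (hd.trans (hHv.degree_le a hav))
  · intro a hau hav
    refine (hmono a ?_ ?_).trans (degree_le_of_adj_imp fun b hb => ?_)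
    · rintro rfl; exact hau hu
    · rintro rfl; exact hav hv
    · exact (hKo a b (fun h => hau h.1) (fun h => hav h.1)).1 hb
  · refine degree_lt_of_adj_imp (c := w') (fun b hb => ?_) hww'
    rcases (hHadj w b).1 hb with h | h
    · exact ⟨(hKo w b (fun h => hwu h.1) (fun h => hwv h.1)).1 h.1, fun hb => h.2 (by rw [hb])⟩
    · rw [Sym2.eq_iff] at h; tauto
  · intro D hCu hCv hpD
    have hwD : w ∈ D := hpD w hw
    have hw'D : w' ∈ D := hpD w' (by simp [hpq])
    refine ⟨fun a b hab => ?_, ?_⟩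
    · rw [hHadj, hKo a b (fun h => hab ⟨hCu h.1, hCu h.2⟩) (fun h => hab ⟨hCv h.1, hCv h.2⟩)]
      have h1 : s(a, b) ≠ s(w, w') := by
        intro h; rw [Sym2.eq_iff] at h
        rcases h with ⟨rfl, rfl⟩ | ⟨rfl, rfl⟩
        · exact hab ⟨hwD, hw'D⟩
        · exact hab ⟨hw'D, hwD⟩
      have h2 : s(a, b) ≠ s(u, v) := by
        intro h; rw [Sym2.eq_iff] at h
        rcases h with ⟨rfl, rfl⟩ | ⟨rfl, rfl⟩
        · exact hab ⟨hCu hu, hCv hv⟩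
        · exact hab ⟨hCv hv, hCu hu⟩
      simp [h1, h2]
    · have key : ∀ a b, T.Adj a b → a ∈ D → b ∈ D → s(a, b) ≠ s(w, w') →
          (H.restrictTo D).Reachable a b := by
        intro a b hab ha hb hne
        by_cases h1 : a ∈ Cu ∧ b ∈ Cu
        · refine (hHu.lift a b hab h1.1 h1.2).mono fun x y hxy => ?_
          refine ⟨(hHadj x y).2 (.inl ⟨(hKu x hxy.2.1 y).2 hxy.1, ?_⟩), hCu hxy.2.1, hCu hxy.2.2⟩
          intro h; rw [Sym2.eq_iff] at h
          rcases h with ⟨rfl, rfl⟩ | ⟨rfl, rfl⟩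
          · exact hwu hxy.2.1
          · exact hwu hxy.2.2
        · by_cases h2 : a ∈ Cv ∧ b ∈ Cv
          · refine (hHv.lift a b hab h2.1 h2.2).mono fun x y hxy => ?_
            refine ⟨(hHadj x y).2 (.inl ⟨(hKv x (fun h => hdisj x h hxy.2.1) y).2 hxy.1, ?_⟩),
              hCv hxy.2.1, hCv hxy.2.2⟩
            intro h; rw [Sym2.eq_iff] at h
            rcases h with ⟨rfl, rfl⟩ | ⟨rfl, rfl⟩
            · exact hwv hxy.2.1
            · exact hwv hxy.2.2
          · exact Adj.reachable ⟨(hHadj a b).2 (.inl ⟨(hKo a b h1 h2).2 hab, hne⟩), ha, hb⟩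
      have r1 : (H.restrictTo D).Reachable u w := q1.reachable_of_edges fun x y hxy => by
        refine key x y (q1.adj_of_mem_edges hxy) (hpD x ?_) (hpD y ?_) ?_
        · rw [hpq, Walk.mem_support_append_iff]; exact .inl (q1.fst_mem_support_of_mem_edges hxy)
        · rw [hpq, Walk.mem_support_append_iff]; exact .inl (q1.snd_mem_support_of_mem_edges hxy)
        · intro h; exact he1 (h ▸ hxy)
      have r2 : (H.restrictTo D).Reachable w' v := q2.reachable_of_edges fun x y hxy => by
        refine key x y (q2.adj_of_mem_edges hxy) (hpD x ?_) (hpD y ?_) ?_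
        · rw [hpq, Walk.mem_support_append_iff]
          exact .inr (by simp [q2.fst_mem_support_of_mem_edges hxy])
        · rw [hpq, Walk.mem_support_append_iff]
          exact .inr (by simp [q2.snd_mem_support_of_mem_edges hxy])
        · intro h; exact he2 (h ▸ hxy)
      have r3 : (H.restrictTo D).Reachable u v :=
        Adj.reachable ⟨(hHadj u v).2 (.inr rfl), hCu hu, hCv hv⟩
      -- The lost edge `ww'` is bypassed: back along the path to `u`, across `uv`, and back to `w'`.
      have r4 : (H.restrictTo D).Reachable w w' := r1.symm.trans (r3.trans r2.symm)
      intro a b hab ha hb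
      by_cases h : s(a, b) = s(w, w')
      · rw [Sym2.eq_iff] at h
        rcases h with ⟨rfl, rfl⟩ | ⟨rfl, rfl⟩
        · exact r4
        · exact r4.symm
      · exact key a b hab ha hb h

/-! ### Extremal tree and minimal obstruction -/

open Classical in
/-- If `G` has no spanning `k`-tree, then there are a spanning tree `T` and a set `X` of vertices of
large `T`-degree, such that `G` and `T` have the same components outside `X`. -/
theorem exists_tree_and_obstruction [Fintype V] {G : SimpleGraph V} {k : ℕ} (hG : G.Connected)
    (hno : ¬ G.HasSpanningKTree k) :
    ∃ T : SimpleGraph V, T.IsTree ∧ ∃ X : Set V, (∃ w ∈ X, k < T.degree w) ∧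
      (∀ w ∈ X, k ≤ T.degree w) ∧
      ∀ a b, G.Adj a b → a ∉ X → b ∉ X → (T.restrictTo Xᶜ).Reachable a b := by
  let excess : SimpleGraph V → ℕ := fun T => ∑ v, (T.degree v - k)
  -- The comparison covers all connected subgraphs, since an exchange is only known to stay
  -- connected; passing to a spanning tree does not raise the excess.
  obtain ⟨T, ⟨hTG, hT⟩, hmin⟩ : ∃ T, (T ≤ G ∧ T.IsTree) ∧
      ∀ H : SimpleGraph V, H ≤ G → H.Connected → excess T ≤ excess H := by
    obtain ⟨T, hT, hTmin⟩ := Set.exists_min_image {T : SimpleGraph V | T ≤ G ∧ T.IsTree} excess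
      (Set.toFinite _) (by obtain ⟨T, h⟩ := hG.exists_isTree_le; exact ⟨T, h⟩)
    refine ⟨T, hT, fun H hHG hH => ?_⟩
    obtain ⟨T', hT'H, hT'⟩ := hH.exists_isTree_le
    exact (hTmin T' ⟨hT'H.trans hHG, hT'⟩).trans <| Finset.sum_le_sum fun v _ =>
      Nat.sub_le_sub_right (degree_le_of_adj_imp fun b hb => hT'H hb) k
  have hbig : ∃ w, k < T.degree w := by
    by_contra! h
    exact hno ⟨T, hTG, hT, maxDegree_le_of_forall_degree_le _ _ h⟩
  let C : Set V → V → Set V := fun X v => {a | (T.restrictTo Xᶜ).Reachable v a}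
  let Good : Set V → Prop := fun X => (∀ w, k < T.degree w → w ∈ X) ∧ (∀ w ∈ X, k ≤ T.degree w) ∧
    ∀ v ∉ X, ∃ H, IsLocalVariant G T (C X v) k H ∧ H.degree v < k
  have hC : ∀ X v, v ∉ X → ∀ a ∈ C X v, a ∉ X := by
    intro X v hv a ha haX
    obtain ⟨p⟩ := (show (T.restrictTo Xᶜ).Reachable v a from ha)
    cases p.reverse with
    | nil => exact hv haX
    | cons h q => exact h.2.1 haX
  have hgood : Good {w | k ≤ T.degree w} := by
    refine ⟨fun w hw => hw.le, fun w hw => hw, fun v hv => ⟨T, ⟨hTG, fun _ _ _ => Iff.rfl, ?_, ?_⟩,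
      not_le.1 hv⟩⟩
    · intro a b hab ha hb
      exact Adj.reachable ⟨hab, ha, hb⟩
    · intro a ha
      exact (not_le.1 (hC _ _ hv a ha)).le
  obtain ⟨X, hX, hXmin⟩ := Set.exists_min_image {X | Good X} Set.ncard (Set.toFinite _) ⟨_, hgood⟩
  refine ⟨T, hT, X, ?_, hX.2.1, ?_⟩
  · obtain ⟨w, hw⟩ := hbig
    exact ⟨w, hX.1 w hw, hw⟩
  intro u v huv hu hv
  by_contra hnr
  obtain ⟨Hu, hHu, hdu⟩ := hX.2.2 u hu
  obtain ⟨Hv, hHv, hdv⟩ := hX.2.2 v hv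
  have hdisj : ∀ a ∈ C X u, a ∉ C X v := fun a h1 h2 => hnr (Reachable.trans h1 (Reachable.symm h2))
  obtain ⟨p, hp⟩ := (hT.connected u v).exists_isPath
  have exch := fun w (hw : w ∈ p.support) (hwX : w ∈ X) => exists_edge_exchange hHu hHv hdisj
    (Reachable.refl u) (Reachable.refl v) hdu hdv huv p hp hw
    (fun h => hC X u hu w h hwX) (fun h => hC X v hv w h hwX)
  have hdeg : ∀ a ∉ X, T.degree a ≤ k := fun a ha => not_lt.1 fun h => ha (hX.1 a h)
  -- At a path vertex of degree above `k`, the exchange would give a connected subgraph of smaller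
  -- excess.
  have hWk : ∀ w ∈ p.support, w ∈ X → T.degree w = k := by
    intro w hw hwX
    refine le_antisymm (not_lt.1 fun hlt => ?_) (hX.2.1 w hwX)
    obtain ⟨H, hHG, h1, h2, h3, h4⟩ := exch w hw hwX
    obtain ⟨-, h5⟩ := h4 Set.univ (Set.subset_univ _) (Set.subset_univ _) (fun _ _ => trivial)
    have hHconn : H.Connected := by
      have := hT.connected.nonempty
      refine ⟨fun a b => ?_⟩
      exact (hT.connected a b).of_adj_imp fun x y hxy =>
        (h5 x y hxy trivial trivial).mono (restrictTo_le _ _)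
    refine absurd (hmin H hHG hHconn) (not_le.2 ?_)
    refine Finset.sum_lt_sum (fun a _ => ?_) ⟨w, Finset.mem_univ _, by omega⟩
    by_cases ha : a ∈ C X u ∨ a ∈ C X v
    · have := h1 a ha; omega
    · have := h2 a (fun h => ha (.inl h)) (fun h => ha (.inr h)); omega
  have hW : ∃ w ∈ p.support, w ∈ X := by
    by_contra! h
    exact hnr <| p.reachable_of_edges fun x y hxy => Adj.reachable ⟨p.adj_of_mem_edges hxy,
      h x (p.fst_mem_support_of_mem_edges hxy), h y (p.snd_mem_support_of_mem_edges hxy)⟩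
  let X' : Set V := X \ {w | w ∈ p.support}
  have hX'X : X' ⊆ X := Set.sdiff_subset
  have hCmono : ∀ z, C X z ⊆ C X' z := fun z a ha =>
    Reachable.mono (restrictTo_mono _ (Set.compl_subset_compl.2 hX'X)) ha
  have hpC : ∀ x ∈ p.support, x ∈ C X' u := by
    intro x hx
    refine (p.takeUntil x hx).reachable_of_edges fun a b hab => ?_
    have hab' := p.edges_takeUntil_subset_edges hx hab
    exact Adj.reachable ⟨p.adj_of_mem_edges hab',
      fun h => h.2 (p.fst_mem_support_of_mem_edges hab'),
      fun h => h.2 (p.snd_mem_support_of_mem_edges hab')⟩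
  have hdeg' : ∀ a ∉ X', T.degree a ≤ k := by
    intro a ha
    by_cases haX : a ∈ X
    · exact (hWk a (by by_contra h; exact ha ⟨haX, h⟩) haX).le
    · exact hdeg a haX
  have hgood' : Good X' := by
    refine ⟨fun w hw => ?_, fun w hw => hX.2.1 w (hX'X hw), fun z hz => ?_⟩
    · refine ⟨hX.1 w hw, fun hwp => ?_⟩
      have := hWk w hwp (hX.1 w hw)
      omega
    by_cases hzX : z ∈ X
    · have hzp : z ∈ p.support := by by_contra h; exact hz ⟨hzX, h⟩
      -- The whole path lies in one component of `T - X'`, so the exchange at `z` is a local variant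
      -- there, and it lowers the degree of `z` from `k`.
      obtain ⟨H, hHG, h1, h2, h3, h4⟩ := exch z hzp hzX
      have hzu : C X' z = C X' u := by
        ext a
        exact ⟨fun h => Reachable.trans (hpC z hzp) h,
          fun h => Reachable.trans (Reachable.symm (hpC z hzp)) h⟩
      have huv' : C X' v = C X' u := by
        ext a
        exact ⟨fun h => Reachable.trans (hpC v p.end_mem_support) h,
          fun h => Reachable.trans (Reachable.symm (hpC v p.end_mem_support)) h⟩
      obtain ⟨h5, h6⟩ := h4 (C X' u) (hCmono u) (huv' ▸ hCmono v) hpC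
      refine ⟨H, ?_, ?_⟩
      · rw [hzu]
        refine ⟨hHG, h5, h6, fun a ha => ?_⟩
        have haX' := hC X' u (fun h => hu (hX'X h)) a ha
        by_cases hau : a ∈ C X u ∨ a ∈ C X v
        · exact h1 a hau
        · exact (h2 a (fun h => hau (.inl h)) (fun h => hau (.inr h))).trans (hdeg' a haX')
      · have := hWk z hzp hzX
        omega
    -- The old variant still serves on the larger component: elsewhere it agrees with `T`, whose
    -- degrees off `X'` are at most `k`.
    · obtain ⟨H, hH, hHz⟩ := hX.2.2 z hzX
      refine ⟨H, ⟨hH.le, fun a b h => hH.agree a b fun h' => h ⟨hCmono z h'.1, hCmono z h'.2⟩,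
        fun a b hab ha hb => ?_, fun a ha => ?_⟩, hHz⟩
      · by_cases h : a ∈ C X z ∧ b ∈ C X z
        · exact (hH.lift a b hab h.1 h.2).mono (restrictTo_mono _ (hCmono z))
        · exact Adj.reachable ⟨(hH.agree a b h).2 hab, ha, hb⟩
      · by_cases h : a ∈ C X z
        · exact hH.degree_le a h
        · exact (degree_le_of_adj_imp fun b hb => (hH.agree a b fun h' => h h'.1).1 hb).trans
            (hdeg' a (hC X' z hz a ha))
  refine absurd (hXmin X' hgood') (not_le.2 (Set.ncard_lt_ncard ?_ (Set.toFinite _)))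
  obtain ⟨w, hwp, hwX⟩ := hW
  exact ⟨hX'X, fun h => (h hwX).2 hwp⟩

/-! ### Counting components and Win's theorem -/

/-- If every vertex is joined to some vertex of `S`, then `|V| ≤ |E| + |S|`. -/
lemma card_le_card_edgeSet_add_card [Fintype V] (H : SimpleGraph V) (S : Finset V)
    (hS : S.Nonempty) (h : ∀ v, ∃ s ∈ S, H.Reachable v s) :
    Nat.card V ≤ H.edgeSet.ncard + S.card := by
  classical
  obtain ⟨r, hr⟩ := hS
  -- A star on `S` centred at `r` makes the graph connected at the cost of at most `|S| - 1` edges.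
  let K : SimpleGraph V := H ⊔ fromEdgeSet ((fun s => s(r, s)) '' (S.erase r : Set V))
  have hrs : ∀ s ∈ S, K.Reachable r s := by
    intro s hs
    by_cases hsr : s = r
    · subst hsr; exact .rfl
    · refine Adj.reachable (.inr ?_)
      rw [fromEdgeSet_adj]
      exact ⟨⟨s, by simp [hsr, hs], rfl⟩, fun h => hsr h.symm⟩
  have hrv : ∀ v, K.Reachable r v := by
    intro v
    obtain ⟨s, hs, hvs⟩ := h v
    exact (hrs s hs).trans (hvs.mono le_sup_left).symm
  have hK : K.Connected := by
    have : Nonempty V := ⟨r⟩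
    exact ⟨fun a b => (hrv a).symm.trans (hrv b)⟩
  have h1 := hK.card_vert_le_card_edgeSet_add_one
  have h2 : K.edgeSet ⊆ H.edgeSet ∪ (fun s => s(r, s)) '' (S.erase r : Set V) := by
    rw [edgeSet_sup]
    refine Set.union_subset_union_right _ ?_
    rw [edgeSet_fromEdgeSet]
    exact Set.sdiff_subset
  have h3 := (Set.ncard_le_ncard h2 (Set.toFinite _)).trans (Set.ncard_union_le _ _)
  have h4 := Set.ncard_image_le (f := fun s => s(r, s)) (Set.toFinite (S.erase r : Set V))
  rw [Set.ncard_coe_finset, Finset.card_erase_of_mem hr] at h4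
  rw [← Nat.card_coe_set_eq] at h3
  have := Finset.card_pos.2 ⟨r, hr⟩
  omega

open Classical in
lemma sum_adj_eq_two_mul_ncard_edgeSet [Fintype V] (H : SimpleGraph V) :
    ∑ a, ∑ b, (if H.Adj a b then 1 else 0) = 2 * H.edgeSet.ncard := by
  have h := H.sum_degrees_eq_twice_card_edges
  rw [← coe_edgeFinset, Set.ncard_coe_finset, ← h]
  refine Finset.sum_congr rfl fun a _ => ?_
  rw [← card_neighborFinset_eq_degree, neighborFinset_eq_filter, Finset.card_filter]

open Classical in
/-- Deleting a nonempty set `X` from a tree `T` leaves at least `2 + ∑ (deg v - 2)` components. -/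
lemma IsTree.card_components_ge [Fintype V] {T : SimpleGraph V} (hT : T.IsTree) {X : Finset V}
    (hX : X.Nonempty) :
    2 + ∑ v ∈ X, T.degree v ≤
      Nat.card (T.restrictTo ((X : Set V)ᶜ)).ConnectedComponent + X.card := by
  -- The vertices of `X` remain in `F` as isolated points, which accounts for `|X|` extra
  -- components.
  set F := T.restrictTo ((X : Set V)ᶜ) with hF
  set Z := T.restrictTo (X : Set V) with hZ
  have hTc : T.edgeSet.ncard + 1 = Nat.card V := by
    have := hT.card_edgeFinset
    rw [← coe_edgeFinset, Set.ncard_coe_finset, Nat.card_eq_fintype_card, this]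
  have hsum : 2 * ∑ v ∈ X, T.degree v + 2 * F.edgeSet.ncard =
      2 * T.edgeSet.ncard + 2 * Z.edgeSet.ncard := by
    have hd : ∀ v, T.degree v = ∑ b, if T.Adj v b then 1 else 0 := fun v => by
      rw [← card_neighborFinset_eq_degree, neighborFinset_eq_filter, Finset.card_filter]
    have h1 : ∑ v ∈ X, T.degree v = ∑ a, ∑ b, if T.Adj a b ∧ a ∈ X then 1 else 0 := by
      rw [← Finset.sum_subset (Finset.subset_univ X)]
      · refine Finset.sum_congr rfl fun a ha => ?_
        simp [hd, ha]
      · intro a _ ha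
        simp [ha]
    have h2 : ∑ v ∈ X, T.degree v = ∑ a, ∑ b, if T.Adj a b ∧ b ∈ X then 1 else 0 := by
      rw [h1, Finset.sum_comm]
      simp only [T.adj_comm]
    rw [two_mul]
    nth_rw 1 [h1]
    rw [h2, ← sum_adj_eq_two_mul_ncard_edgeSet, ← sum_adj_eq_two_mul_ncard_edgeSet,
      ← sum_adj_eq_two_mul_ncard_edgeSet]
    simp only [← Finset.sum_add_distrib]
    refine Finset.sum_congr rfl fun a _ => Finset.sum_congr rfl fun b _ => ?_
    simp only [hF, hZ, restrictTo_adj, Set.mem_compl_iff, Finset.mem_coe]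
    by_cases h : T.Adj a b <;> by_cases ha : a ∈ X <;> by_cases hb : b ∈ X <;> simp [h, ha, hb]
  -- Every vertex reaches `X` along `T` without using an edge inside `X`, so `T \ Z` has at least
  -- `|V| - |X|` edges.
  have hZc : Z.edgeSet.ncard + 1 ≤ X.card := by
    have h := card_le_card_edgeSet_add_card (T \ Z) X hX (by
      intro v
      obtain ⟨x, hx⟩ := hX
      obtain ⟨p⟩ := hT.connected v x
      induction p with
      | nil => exact ⟨_, hx, .rfl⟩
      | @cons a b _ hab q ih =>
        by_cases ha : a ∈ X
        · exact ⟨a, ha, .rfl⟩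
        · obtain ⟨s, hs, hbs⟩ := ih hx
          have hab' : (T \ Z).Adj a b := ⟨hab, fun h => ha h.2.1⟩
          exact ⟨s, hs, hab'.reachable.trans hbs⟩)
    have hsub : Z.edgeSet ⊆ T.edgeSet := edgeSet_mono fun a b h => h.1
    rw [edgeSet_sdiff] at h
    have := Set.ncard_sdiff_add_ncard_of_subset hsub (Set.toFinite _)
    omega
  have hFc : Nat.card V ≤ F.edgeSet.ncard + Nat.card F.ConnectedComponent := by
    have hV := hT.connected.nonempty
    have h := card_le_card_edgeSet_add_card F
      (Finset.univ.image fun c : F.ConnectedComponent => c.out)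
      (Finset.univ_nonempty.image _)
      (fun v => ⟨_, Finset.mem_image_of_mem _ (Finset.mem_univ (F.connectedComponentMk v)),
        (ConnectedComponent.exact (Quot.out_eq (F.connectedComponentMk v))).symm⟩)
    refine h.trans (Nat.add_le_add_left ?_ _)
    rw [Nat.card_eq_fintype_card]
    exact Finset.card_image_le
  omega

open Classical in
/-- **Win's theorem.** If `G` has no spanning `k`-tree, then deleting some nonempty set `X` of
vertices leaves at least `(k - 2)|X| + 3` components. -/
theorem exists_many_components [Fintype V] {G : SimpleGraph V} {k : ℕ} (hk : 2 ≤ k)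
    (hG : G.Connected) (hno : ¬ G.HasSpanningKTree k) :
    ∃ (X : Finset V) (P : Finset (Finset V)), X.Nonempty ∧ (k - 2) * X.card + 3 ≤ P.card ∧
      (∀ A ∈ P, A.Nonempty ∧ Disjoint A X) ∧ (P : Set (Finset V)).PairwiseDisjoint id ∧
      ∀ A ∈ P, ∀ a ∈ A, ∀ b, G.Adj a b → b ∈ A ∨ b ∈ X := by
  obtain ⟨T, hT, X', ⟨w, hwX, hw⟩, hdeg, hcomp⟩ := exists_tree_and_obstruction hG hno
  obtain ⟨X, rfl⟩ : ∃ X : Finset V, X' = X := ⟨X'.toFinset, by simp⟩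
  have hcard := hT.card_components_ge ⟨w, hwX⟩
  set F := T.restrictTo ((X : Set V)ᶜ) with hF
  let part : F.ConnectedComponent → Finset V :=
    fun c => Finset.univ.filter fun a => F.connectedComponentMk a = c
  have hmem : ∀ c a, a ∈ part c ↔ F.connectedComponentMk a = c := fun c a => by simp [part]
  have hne : ∀ c, (part c).Nonempty := fun c => by
    obtain ⟨a, rfl⟩ := c.exists_rep
    exact ⟨a, (hmem _ _).2 rfl⟩
  have hinj : Function.Injective part := by
    intro c c' h
    obtain ⟨a, ha⟩ := hne c
    have ha' := ha
    rw [h, hmem] at ha'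
    rw [← (hmem _ _).1 ha, ha']
  refine ⟨X, (Finset.univ \ X.image F.connectedComponentMk).image part, ⟨w, hwX⟩, ?_, ?_, ?_, ?_⟩
  -- The `3` is the `2` from the tree count plus `1` from the vertex of degree above `k`.
  · rw [Finset.card_image_of_injective _ hinj]
    have h1 := Finset.le_card_sdiff (X.image F.connectedComponentMk) Finset.univ
    have h2 : (X.image F.connectedComponentMk).card ≤ X.card := Finset.card_image_le
    rw [Finset.card_univ, ← Nat.card_eq_fintype_card] at h1
    have h3 : X.card * k < ∑ v ∈ X, T.degree v := by
      rw [← smul_eq_mul, ← Finset.sum_const]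
      exact Finset.sum_lt_sum (fun v hv => hdeg v hv) ⟨w, hwX, hw⟩
    obtain ⟨q, rfl⟩ := Nat.exists_eq_add_of_le hk
    have h4 : X.card * (2 + q) = 2 * X.card + q * X.card := by ring
    rw [Nat.add_sub_cancel_left]
    omega
  · intro A hA
    obtain ⟨c, hc, rfl⟩ := Finset.mem_image.1 hA
    refine ⟨hne c, Finset.disjoint_left.2 fun a ha haX => ?_⟩
    exact (Finset.mem_sdiff.1 hc).2 (Finset.mem_image.2 ⟨a, haX, (hmem _ _).1 ha⟩)
  · intro A hA B hB hAB
    obtain ⟨c, hc, rfl⟩ := Finset.mem_image.1 hA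
    obtain ⟨c', hc', rfl⟩ := Finset.mem_image.1 hB
    refine Finset.disjoint_left.2 fun a ha ha' => hAB ?_
    rw [← (hmem _ _).1 ha, ← (hmem _ _).1 ha']
  · intro A hA a ha b hab
    obtain ⟨c, hc, rfl⟩ := Finset.mem_image.1 hA
    by_cases hb : b ∈ X
    · exact .inr hb
    · have haX : a ∉ X := fun haX =>
        (Finset.mem_sdiff.1 hc).2 (Finset.mem_image.2 ⟨a, haX, (hmem _ _).1 ha⟩)
      refine .inl ((hmem _ _).2 ?_)
      rw [← (hmem _ _).1 ha]
      exact ConnectedComponent.sound (hcomp a b hab haX hb).symm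

/-! ### Edge cuts in regular graphs -/

lemma isEdgeConnected_edgeConnectivity (G : SimpleGraph V) :
    G.IsEdgeConnected G.edgeConnectivity := by
  by_cases h : BddAbove {m : ℕ | G.IsEdgeConnected m}
  · exact Nat.sSup_mem ⟨0, IsEdgeConnected.zero⟩ h
  -- The unbounded case, with default supremum `0`.
  · rw [edgeConnectivity, Nat.sSup_of_not_bddAbove h]
    exact IsEdgeConnected.zero

variable [Fintype V] [DecidableEq V] {G : SimpleGraph V} [DecidableRel G.Adj]

/-- The edges leaving a proper part `A` number at least the edge connectivity. -/
lemma edgeConnectivity_le_cut {A X : Finset V} (hA : A.Nonempty) (hX : X.Nonempty)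
    (hAX : Disjoint A X) (hout : ∀ a ∈ A, ∀ b, G.Adj a b → b ∈ A ∨ b ∈ X) :
    G.edgeConnectivity ≤ ∑ a ∈ A, (G.neighborFinset a ∩ X).card := by
  by_contra! hlt
  obtain ⟨a, ha⟩ := hA
  obtain ⟨x, hx⟩ := hX
  let s : Finset (Sym2 V) :=
    (A.sigma fun a => G.neighborFinset a ∩ X).image fun e => s(e.1, e.2)
  have hs : s.card < G.edgeConnectivity := by
    refine lt_of_le_of_lt Finset.card_image_le ?_
    rwa [Finset.card_sigma]
  obtain ⟨p⟩ := isEdgeConnected_edgeConnectivity G a x (s := s)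
    (by rw [Set.encard_coe_eq_coe_finsetCard]; exact_mod_cast hs)
  have hclosed : ∀ {u v : V}, (G.deleteEdges s).Walk u v → u ∈ A → v ∈ A := by
    intro u v p
    induction p with
    | nil => exact id
    | @cons u v _ h q ih =>
      intro hu
      rw [deleteEdges_adj] at h
      refine ih ((hout u hu v h.1).resolve_right fun hvX => h.2 ?_)
      exact Finset.mem_image.2 ⟨⟨u, v⟩, by simp [hu, hvX, h.1], rfl⟩
  exact Finset.disjoint_left.1 hAX (hclosed p ha) hx

lemma degree_eq_card_add_card {A X : Finset V} (hAX : Disjoint A X) {a : V}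
    (hout : ∀ b, G.Adj a b → b ∈ A ∨ b ∈ X) :
    G.degree a = (G.neighborFinset a ∩ A).card + (G.neighborFinset a ∩ X).card := by
  rw [← card_neighborFinset_eq_degree, ← Finset.card_union_of_disjoint
    (hAX.mono Finset.inter_subset_right Finset.inter_subset_right), ← Finset.inter_union_distrib_left]
  congr 1
  ext b
  simp only [Finset.mem_inter, mem_neighborFinset, Finset.mem_union]
  exact ⟨fun h => ⟨h, hout b h⟩, fun h => h.1⟩

/-- A part left by fewer than `d` edges of a `d`-regular graph has more than `d` vertices. -/
lemma IsRegularOfDegree.lt_card_of_cut_lt {d : ℕ} (hreg : G.IsRegularOfDegree d) {A X : Finset V}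
    (hA : A.Nonempty) (hAX : Disjoint A X) (hout : ∀ a ∈ A, ∀ b, G.Adj a b → b ∈ A ∨ b ∈ X)
    (hlt : ∑ a ∈ A, (G.neighborFinset a ∩ X).card < d) : d + 1 ≤ A.card := by
  by_contra! hcard
  have h1 : ∀ a ∈ A, d + 1 - A.card ≤ (G.neighborFinset a ∩ X).card := by
    intro a ha
    have h2 := degree_eq_card_add_card hAX (hout a ha)
    have h3 : (G.neighborFinset a ∩ A).card < A.card :=
      Finset.card_lt_card ((Finset.ssubset_iff_of_subset Finset.inter_subset_right).2
        ⟨a, ha, by simp⟩)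
    rw [hreg a] at h2
    omega
  -- The cut has at least `|A|(d + 1 - |A|)` edges, which is at least `d` for `1 ≤ |A| ≤ d`.
  have h2 := Finset.card_nsmul_le_sum A _ _ h1
  have h3 := hA.card_pos
  obtain ⟨r, hr⟩ := Nat.exists_eq_add_of_le (Nat.lt_succ_iff.1 hcard)
  obtain ⟨q, hq⟩ := Nat.exists_eq_add_of_le h3
  have h4 : d + 1 - A.card = r + 1 := by omega
  rw [h4, smul_eq_mul, hq] at h2
  nlinarith

/-! ### Eigenvalues from disjoint parts -/

/-- The Rayleigh quotient bound for vectors orthogonal to the leading eigenvectors. -/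
lemma _root_.Matrix.IsHermitian.dotProduct_mulVec_le {A : Matrix V V ℝ} (hA : A.IsHermitian)
    (i : Fin (Fintype.card V)) (y : V → ℝ)
    (hy : ∀ v, (Fintype.equivOfCardEq (Fintype.card_fin _)).symm v < i →
      inner ℝ (hA.eigenvectorBasis v) (WithLp.toLp 2 y) = 0) :
    y ⬝ᵥ A.mulVec y ≤ hA.eigenvalues₀ i * (y ⬝ᵥ y) := by
  set b := hA.eigenvectorBasis
  set Y : EuclideanSpace ℝ V := WithLp.toLp 2 y
  have hinner : ∀ z : V → ℝ, inner ℝ Y (WithLp.toLp 2 z) = y ⬝ᵥ z := fun z => by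
    simp [Y, EuclideanSpace.inner_eq_star_dotProduct, dotProduct_comm]
  have h1 : y ⬝ᵥ y = ∑ v, inner ℝ (b v) Y * inner ℝ (b v) Y := by
    rw [← hinner y, ← b.sum_inner_mul_inner Y (WithLp.toLp 2 y)]
    exact Finset.sum_congr rfl fun v _ => by rw [real_inner_comm]
  have h2 : y ⬝ᵥ A.mulVec y = ∑ v, hA.eigenvalues v * (inner ℝ (b v) Y * inner ℝ (b v) Y) := by
    rw [← hinner, ← b.sum_inner_mul_inner]
    refine Finset.sum_congr rfl fun v _ => ?_
    have h3 : inner ℝ (b v) (WithLp.toLp 2 (A.mulVec y)) = hA.eigenvalues v * inner ℝ (b v) Y := by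
      have h4 := hA.mulVec_eigenvectorBasis v
      have hT : A.transpose = A := 
        (Matrix.conjTranspose_eq_transpose_of_trivial A).symm.trans hA
      simp only [EuclideanSpace.inner_eq_star_dotProduct, star_trivial, Y, b]
      rw [dotProduct_comm, Matrix.dotProduct_mulVec, ← Matrix.mulVec_transpose, hT, h4,
        smul_dotProduct, smul_eq_mul, dotProduct_comm]
    rw [h3, real_inner_comm]
    ring
  rw [h1, h2, Finset.mul_sum]
  refine Finset.sum_le_sum fun v _ => ?_
  by_cases hv : (Fintype.equivOfCardEq (Fintype.card_fin _)).symm v < i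
  · simp [hy v hv]
  · exact mul_le_mul_of_nonneg_right (hA.eigenvalues₀_antitone (not_lt.1 hv)) (mul_self_nonneg _)

/-- Disjoint parts without edges between them, each of average degree at least `θ`, force as many
eigenvalues to be at least `θ`. -/
theorem le_adjEigenvalue_of_parts {θ : ℝ} {P : Finset (Finset V)}
    (hne : ∀ A ∈ P, A.Nonempty) (hdisj : (P : Set (Finset V)).PairwiseDisjoint id)
    (hedge : ∀ A ∈ P, ∀ B ∈ P, ∀ a ∈ A, ∀ b ∈ B, G.Adj a b → A = B)
    (hθ : ∀ A ∈ P, θ * A.card ≤ ∑ a ∈ A, ((G.neighborFinset a ∩ A).card : ℝ))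
    (i : Fin (Fintype.card V)) (hi : (i : ℕ) < P.card) : θ ≤ G.adjEigenvalue i := by
  have hA := G.isHermitian_adjMatrix ℝ
  -- `y c` takes the value `c A` on each part `A` and `0` elsewhere.
  let y : (P → ℝ) →ₗ[ℝ] (V → ℝ) :=
    { toFun := fun c v => ∑ A : P, if v ∈ A.1 then c A else 0
      map_add' := fun c c' => by
        ext v; simp only [Pi.add_apply, ← Finset.sum_add_distrib]
        exact Finset.sum_congr rfl fun A _ => by split_ifs <;> simp
      map_smul' := fun r c => by
        ext v; simp [Finset.mul_sum] }
  have hy : ∀ (c : P → ℝ) (A : P), ∀ v ∈ A.1, y c v = c A := by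
    intro c A v hv
    change ∑ B : P, (if v ∈ B.1 then c B else 0) = c A
    rw [Finset.sum_eq_single A, if_pos hv]
    · intro B _ hBA
      refine if_neg fun hvB => hBA (Subtype.ext ?_)
      by_contra h
      exact Finset.disjoint_left.1 (hdisj B.2 A.2 h) hvB hv
    · simp
  have hy0 : ∀ (c : P → ℝ) (v : V), (∀ A ∈ P, v ∉ A) → y c v = 0 := by
    intro c v hv
    exact Finset.sum_eq_zero fun B _ => if_neg (hv B.1 B.2)
  let f : (P → ℝ) →ₗ[ℝ] (Fin i → ℝ) :=
    LinearMap.pi fun j => ((innerSL ℝ (hA.eigenvectorBasis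
      (Fintype.equivOfCardEq (Fintype.card_fin _) (Fin.castLE i.2.le j)))).toLinearMap ∘ₗ
      (WithLp.linearEquiv 2 ℝ (V → ℝ)).symm.toLinearMap ∘ₗ y)
  -- Orthogonality to the `i` leading eigenvectors imposes `i < |P|` linear conditions, so some
  -- nonzero `c` satisfies them.
  obtain ⟨c, hc, hc0⟩ := (Submodule.ne_bot_iff _).1
    (LinearMap.ker_ne_bot_of_finrank_lt (f := f) (by simpa using hi))
  have hray := hA.dotProduct_mulVec_le i (y c) (by
    intro v hv
    have := congrFun (LinearMap.mem_ker.1 hc)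
      ⟨((Fintype.equivOfCardEq (Fintype.card_fin _)).symm v : Fin (Fintype.card V)), hv⟩
    simpa [f] using this)
  obtain ⟨A₀, hA₀⟩ := Function.ne_iff.1 hc0
  have hpos : 0 < y c ⬝ᵥ y c := by
    obtain ⟨a, ha⟩ := hne A₀.1 A₀.2
    refine Finset.sum_pos' (fun v _ => mul_self_nonneg _) ⟨a, Finset.mem_univ _, ?_⟩
    rw [hy c A₀ a ha]
    exact mul_self_pos.2 hA₀
  have hsum : ∀ z : V → ℝ, y c ⬝ᵥ z = ∑ A : P, c A * ∑ a ∈ A.1, z a := by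
    intro z
    simp only [Finset.mul_sum]
    change ∑ v, (∑ A : P, if v ∈ A.1 then c A else 0) * z v = _
    simp only [Finset.sum_mul]
    rw [Finset.sum_comm]
    refine Finset.sum_congr rfl fun A _ => ?_
    simp [ite_mul, Finset.sum_ite_mem]
  have hlow : θ * (y c ⬝ᵥ y c) ≤ y c ⬝ᵥ (G.adjMatrix ℝ).mulVec (y c) := by
    rw [hsum, hsum, Finset.mul_sum]
    refine Finset.sum_le_sum fun A _ => ?_
    have e1 : ∑ a ∈ A.1, y c a = A.1.card * c A := by
      rw [Finset.sum_congr rfl fun a ha => hy c A a ha]; simp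
    have e2 : ∑ a ∈ A.1, (G.adjMatrix ℝ).mulVec (y c) a =
        c A * ∑ a ∈ A.1, ((G.neighborFinset a ∩ A.1).card : ℝ) := by
      rw [Finset.mul_sum]
      refine Finset.sum_congr rfl fun a ha => ?_
      rw [adjMatrix_mulVec_apply, ← Finset.sum_subset (Finset.inter_subset_left (s₂ := A.1)),
        Finset.sum_congr rfl fun b hb => hy c A b (Finset.mem_inter.1 hb).2]
      · simp [mul_comm]
      · intro b hb hbA
        refine hy0 c b fun B hB hbB => hbA (Finset.mem_inter.2 ⟨hb, ?_⟩)
        rw [mem_neighborFinset] at hb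
        exact hedge A.1 A.2 B hB a ha b hbB hb ▸ hbB
    rw [e1, e2]
    nlinarith [mul_le_mul_of_nonneg_left (hθ A.1 A.2) (mul_self_nonneg (c A))]
  exact le_of_mul_le_mul_right (hlow.trans hray) hpos

/-! ### Counting parts with few outgoing edges -/

/-- In a `d`-regular graph, the edges between a set `X` and disjoint parts number at most
`d * |X|`. -/
lemma IsRegularOfDegree.sum_cut_le {d : ℕ} (hreg : G.IsRegularOfDegree d) {X : Finset V}
    {P : Finset (Finset V)} (hdisj : (P : Set (Finset V)).PairwiseDisjoint id) :
    ∑ A ∈ P, ∑ a ∈ A, (G.neighborFinset a ∩ X).card ≤ d * X.card := by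
  have h1 : ∀ a, (G.neighborFinset a ∩ X).card = ∑ b ∈ X, if G.Adj a b then 1 else 0 := by
    intro a
    rw [← Finset.card_filter]
    congr 1
    ext b
    simp [and_comm]
  have h2 := Finset.sum_biUnion (f := fun a => (G.neighborFinset a ∩ X).card) hdisj
  simp only [id] at h2
  rw [← h2]
  refine (Finset.sum_le_sum_of_subset (Finset.subset_univ _)).trans ?_
  simp only [h1]
  rw [Finset.sum_comm, mul_comm, ← smul_eq_mul]
  refine Finset.sum_le_card_nsmul _ _ _ fun b _ => le_of_eq ?_
  rw [← hreg b, ← card_neighborFinset_eq_degree, neighborFinset_eq_filter, Finset.card_filter]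
  simp only [G.adj_comm b]

/-- If the parts `P` of `G - X` are more than `q|X| + 2` in number, then at least `3d / (d - qκ')`
of them are left by fewer than `d / q` edges. -/
lemma IsRegularOfDegree.three_mul_le_card_filter {d q : ℕ} (hreg : G.IsRegularOfDegree d)
    {X : Finset V} {P : Finset (Finset V)} (hX : X.Nonempty) (hcard : q * X.card + 3 ≤ P.card)
    (hP : ∀ A ∈ P, A.Nonempty ∧ Disjoint A X)
    (hdisj : (P : Set (Finset V)).PairwiseDisjoint id)
    (hout : ∀ A ∈ P, ∀ a ∈ A, ∀ b, G.Adj a b → b ∈ A ∨ b ∈ X) :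
    (3 * d : ℤ) ≤ (P.filter fun A => q * ∑ a ∈ A, (G.neighborFinset a ∩ X).card < d).card *
      (d - q * G.edgeConnectivity) := by
  set t : Finset V → ℕ := fun A => ∑ a ∈ A, (G.neighborFinset a ∩ X).card
  change (3 * d : ℤ) ≤ (P.filter fun A => q * t A < d).card * (d - q * G.edgeConnectivity)
  have h1 : q * ∑ A ∈ P, t A ≤ q * (d * X.card) := Nat.mul_le_mul_left q (hreg.sum_cut_le hdisj)
  rw [Finset.mul_sum, ← Finset.sum_filter_add_sum_filter_not P (fun A => q * t A < d)] at h1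
  have h2 := Finset.card_nsmul_le_sum (P.filter fun A => q * t A < d) (fun A => q * t A)
    (q * G.edgeConnectivity) fun A hA => by
      have hA := (Finset.mem_filter.1 hA).1
      exact Nat.mul_le_mul_left q
        (edgeConnectivity_le_cut (hP A hA).1 hX (hP A hA).2 (hout A hA))
  have h3 := Finset.card_nsmul_le_sum (P.filter fun A => ¬ q * t A < d) (fun A => q * t A)
    d fun A hA => not_lt.1 (Finset.mem_filter.1 hA).2
  have h4 := Finset.card_filter_add_card_filter_not (s := P) fun A => q * t A < d
  rw [smul_eq_mul] at h2 h3
  generalize (P.filter fun A => q * t A < d).card = m at *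
  generalize (P.filter fun A => ¬ q * t A < d).card = m' at *
  generalize ∑ A ∈ P with q * t A < d, q * t A = σ at *
  generalize ∑ A ∈ P with ¬ q * t A < d, q * t A = σ' at *
  -- The facts combine to `mqκ' + m'd ≤ qd|X| ≤ d(m + m' - 3)`. Integers are needed because `d -
  -- qκ'` is not yet known to be positive.
  zify at h1 h2 h3 h4 hcard ⊢
  have h5 := mul_le_mul_of_nonneg_right hcard (Int.natCast_nonneg d)
  rw [← h4] at h5
  nlinarith

end SimpleGraph

/-! ### The spectral condition -/

theorem mainTheorem8 {V : Type*} [Fintype V] [DecidableEq V] (G : SimpleGraph V)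
    [DecidableRel G.Adj] (k d : ℕ) (l : ℤ) (hk : 3 ≤ k) (hconn : G.Connected)
    (hreg : G.IsRegularOfDegree d)
    (hl : l = (d : ℤ) - ((k : ℤ) - 2) * (G.edgeConnectivity : ℤ)) :
    (l ≤ 0 → G.HasSpanningKTree k) ∧
    (0 < l →
      (∀ i : Fin (Fintype.card V), (i : ℕ) + 1 = ⌈(3 * d : ℝ) / (l : ℝ)⌉₊ →
        G.adjEigenvalue i < (d : ℝ) - (d : ℝ) / (((k : ℝ) - 2) * ((d : ℝ) + 1))) →
      G.HasSpanningKTree k) := by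
  by_cases hno : G.HasSpanningKTree k
  · exact ⟨fun _ => hno, fun _ _ => hno⟩
  obtain ⟨X, P, hX, hcard, hP, hdisj, hout⟩ :=
    SimpleGraph.exists_many_components (by omega) hconn hno
  obtain ⟨q, rfl⟩ := Nat.exists_eq_add_of_le (show 2 ≤ k by omega)
  rw [Nat.add_sub_cancel_left] at hcard
  have hlq : l = d - q * G.edgeConnectivity := by rw [hl]; push_cast; ring
  have hJ := hreg.three_mul_le_card_filter hX hcard hP hdisj hout
  rw [← hlq] at hJ
  set J := P.filter fun A => q * ∑ a ∈ A, (G.neighborFinset a ∩ X).card < d with hJdef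
  have hd : 0 < d := by
    obtain ⟨x, hx⟩ := hX
    obtain ⟨A, hA⟩ := Finset.card_pos.1 (by omega : 0 < P.card)
    obtain ⟨a, ha⟩ := (hP A hA).1
    have : Nontrivial V := ⟨a, x, fun h => Finset.disjoint_left.1 (hP A hA).2 ha (h ▸ hx)⟩
    rw [← hreg a]
    exact hconn.preconnected.degree_pos_of_nontrivial a
  -- Part (i): `0 < 3d ≤ |J| l` excludes `l ≤ 0`.
  have hlpos : 0 < l := by
    by_contra! h
    have := mul_nonpos_of_nonneg_of_nonpos (Int.natCast_nonneg J.card) h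
    omega
  refine ⟨fun h => absurd h (not_le.2 hlpos), fun _ heig => ?_⟩
  exfalso
  have hJP : ∀ A ∈ J, A ∈ P := fun A hA => (Finset.mem_filter.1 hA).1
  have hlR : (0 : ℝ) < l := by exact_mod_cast hlpos
  have hdR : (0 : ℝ) < d := by exact_mod_cast hd
  have hceil : ⌈(3 * d : ℝ) / (l : ℝ)⌉₊ ≤ J.card := by
    rw [Nat.ceil_le, div_le_iff₀ hlR]
    exact_mod_cast hJ
  have hceil_pos : 0 < ⌈(3 * d : ℝ) / (l : ℝ)⌉₊ := Nat.ceil_pos.2 (by positivity)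
  have hJdisj : (J : Set (Finset V)).PairwiseDisjoint id := hdisj.subset fun A hA => hJP A hA
  -- The nonempty disjoint parts number at most `|V|`, so the eigenvalue in question exists.
  have hJV : J.card ≤ Fintype.card V :=
    (Finset.card_le_card_biUnion hJdisj fun A hA => (hP A (hJP A hA)).1).trans
      (Finset.card_le_univ _)
  -- Indices start at `0`, hence the shift by one.
  refine absurd (heig ⟨⌈(3 * d : ℝ) / (l : ℝ)⌉₊ - 1, by omega⟩ (Nat.sub_add_cancel hceil_pos))
    (not_lt.2 (SimpleGraph.le_adjEigenvalue_of_parts (P := J)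
      (fun A hA => (hP A (hJP A hA)).1) hJdisj ?_ ?_ _
      (lt_of_lt_of_le (Nat.sub_lt hceil_pos one_pos) hceil)))
  · intro A hA B hB a ha b hb hab
    by_contra hne
    rcases hout A (hJP A hA) a ha b hab with h | h
    · exact Finset.disjoint_left.1 (hJdisj hA hB hne) h hb
    · exact Finset.disjoint_left.1 (hP B (hJP B hB)).2 hb h
  · intro A hA
    have hAP := hJP A hA
    have hlt := (Finset.mem_filter.1 hA).2
    set t := ∑ a ∈ A, (G.neighborFinset a ∩ X).card with ht
    have hq : 1 ≤ q := by omega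
    have hAcard := hreg.lt_card_of_cut_lt (hP A hAP).1 (hP A hAP).2 (hout A hAP)
      (lt_of_le_of_lt (Nat.le_mul_of_pos_left t hq) hlt)
    have hsum : (∑ a ∈ A, ((G.neighborFinset a ∩ A).card : ℝ)) + t = d * A.card := by
      rw [ht]
      push_cast
      rw [← Finset.sum_add_distrib, Finset.sum_congr rfl fun a ha => by
        rw [← Nat.cast_add, ← SimpleGraph.degree_eq_card_add_card (hP A hAP).2 (hout A hAP a ha),
          hreg a]]
      simp [mul_comm]
    have hqR : (1 : ℝ) ≤ q := by exact_mod_cast hq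
    have hltR : (q : ℝ) * t ≤ d := by exact_mod_cast hlt.le
    have hAR : (d : ℝ) + 1 ≤ A.card := by exact_mod_cast hAcard
    -- Multiply `qt ≤ d` by `d + 1 ≤ |A|`.
    have key : (t : ℝ) ≤ d / (((2 + q : ℕ) - 2 : ℝ) * (d + 1)) * A.card := by
      have : ((2 + q : ℕ) - 2 : ℝ) = q := by push_cast; ring
      rw [this, div_mul_eq_mul_div, le_div_iff₀ (by positivity)]
      nlinarith [mul_le_mul hltR hAR (by positivity) hdR.le]
    linarith [sub_mul (d : ℝ) (d / (((2 + q : ℕ) - 2 : ℝ) * (d + 1))) A.card]
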